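/- A finite group $G$ is called exponent-critical if its exponent is not the least common multiple of the exponents of its proper non-abelian subgroups (the least common multiple of the empty family being $1$). An exponent-critical $p$-group has type $\mathcal A$ if exactly one of its maximal subgroups is abelian. Let $p$ be a prime and $m\ge 2$ an integer, and suppose that $p$ is odd or $m\ge 3$. Let $W=\langle a_0\rangle\times\langle a_1\rangle\times\cdots\times\langle a_{p-1}\rangle$ be the abelian group in which $a_0$ has order $p^m$ and $a_1,\dots,a_{p-1}$ have order $p^{m-1}$. Let $\phi$ be the automorphism of $W$ with $\phi(a_i)=a_ia_{i+1}$ for $0\le i\le p-2$ and $\phi(a_{p-1})=a_{p-1}\prod_{j=1}^{p-1}a_j^{-\binom pj}$. Let $U=W\rtimes\langle b_0\rangle$, where $b_0$ has order $p^{m-1}$ and $b_0^{-1}wb_0=\phi(w)$ for all $w\in W$, and let $D$ be the normal subgroup of $U$ generated by $a_0^{p^{m-1}}a_{p-1}^{p^{m-2}}$, which has order $p$. Then there is, up to isomorphism, a unique largest non-abelian exponent-critical $p$-group of exponent $p^m$ and type $\mathcal A$, namely $U/D$, and its order is $p^{(m-1)(p+1)}$. That is: $U/D$ is a non-abelian exponent-critical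 $p$-group of exponent $p^m$ and type $\mathcal A$ of order $p^{(m-1)(p+1)}$; and every non-abelian exponent-critical $p$-group $P$ of exponent $p^m$ and type $\mathcal A$ is isomorphic to a quotient of $U/D$, so that $|P|\le |U/D|$, and $P\cong U/D$ whenever $|P|=|U/D|$. -/

import Mathlib

namespace ExpCrit

/-- A finite group is exponent-critical if its exponent is not the least common multiple of the
exponents of its proper non-abelian subgroups (the least common multiple of the empty family
being `1`). -/
def IsExponentCritical (G : Type*) [Group G] [Finite G] : Prop :=
  Monoid.exponent G ≠
    (Set.toFinite {H : Subgroup G | H ≠ ⊤ ∧ ¬ IsMulCommutative H}).toFinset.lcm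
      fun H => Monoid.exponent H

/-- Exactly one maximal subgroup is abelian. -/
def HasUniqueAbelianMaximal (G : Type*) [Group G] : Prop :=
  ∃! M : Subgroup G, IsCoatom M ∧ IsMulCommutative M

/-- `P` is a non-abelian exponent-critical `p`-group of exponent `p ^ m` and of type `A`. -/
structure IsTypeA (p m : ℕ) (P : Type*) [Group P] [Finite P] : Prop where
  isPGroup : IsPGroup p P
  nonabelian : ¬ IsMulCommutative P
  exponentCritical : IsExponentCritical P
  exponent_eq : Monoid.exponent P = p ^ m
  typeA : HasUniqueAbelianMaximal P

section Construction

variable (p m : ℕ)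

/-- The order of the generator `a i`: it is `p ^ m` for `i = 0` and `p ^ (m - 1)` otherwise. -/
def ord (i : Fin p) : ℕ := if (i : ℕ) = 0 then p ^ m else p ^ (m - 1)

/-- The group `W`, written additively: the direct product of the cyclic groups `⟨a i⟩`,
`0 ≤ i ≤ p - 1`. -/
abbrev AddW : Type := (i : Fin p) → ZMod (ord p m i)

/-- The generator `a i` of `W`, in additive notation. -/
def a (i : Fin p) : AddW p m := Pi.single i 1

/-- The generator `a j` for a natural number `j < p` (and `0` for the other `j`, which do not
occur). -/
def aN (j : ℕ) : AddW p m := if h : j < p then a p m ⟨j, h⟩ else 0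

/-- The image of `a i` under `φ`, in additive notation: `a i + a (i + 1)` for `i ≤ p - 2`, and
`a i - ∑ j ∈ {1, …, p - 1}, (p choose j) • a j` for `i = p - 1`. -/
def phiGen (i : Fin p) : AddW p m :=
  if (i : ℕ) + 1 < p then aN p m i + aN p m (i + 1)
  else aN p m i - ∑ j ∈ Finset.Icc 1 (p - 1), p.choose j • aN p m j

theorem ord_nsmul_a (i : Fin p) : ord p m i • a p m i = 0 := by
  unfold a
  rw [← Pi.single_smul]
  simp

theorem pow_nsmul_aN (j : ℕ) : p ^ m • aN p m j = 0 := by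
  unfold aN
  split_ifs with h
  · have h1 : ord p m ⟨j, h⟩ ∣ p ^ m := by
      unfold ord
      split_ifs
      · exact dvd_rfl
      · exact pow_dvd_pow _ (Nat.sub_le _ _)
    obtain ⟨c, hc⟩ := h1
    rw [hc, mul_comm, mul_nsmul', ord_nsmul_a, nsmul_zero]
  · simp

theorem pow_pred_nsmul_aN (j : ℕ) (hj : j ≠ 0) : p ^ (m - 1) • aN p m j = 0 := by
  unfold aN
  split_ifs with h
  · have h1 : ord p m ⟨j, h⟩ = p ^ (m - 1) := by simp [ord, hj]
    rw [← h1, ord_nsmul_a]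
  · simp

theorem end_sub_apply (f g : AddMonoid.End (AddW p m)) (x : AddW p m) :
    (f - g) x = f x - g x := rfl

theorem end_mul_apply (f g : AddMonoid.End (AddW p m)) (x : AddW p m) :
    (f * g) x = f (g x) := rfl

theorem end_one_apply (x : AddW p m) : (1 : AddMonoid.End (AddW p m)) x = x := rfl

theorem end_add_apply (f g : AddMonoid.End (AddW p m)) (x : AddW p m) :
    (f + g) x = f x + g x := rfl

theorem end_sum_apply (s : Finset ℕ) (f : ℕ → AddMonoid.End (AddW p m)) (x : AddW p m) :
    (∑ j ∈ s, f j) x = ∑ j ∈ s, f j x := by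
  classical
  induction s using Finset.induction_on with
  | empty => rfl
  | insert b s hb ih => rw [Finset.sum_insert hb, Finset.sum_insert hb, end_add_apply, ih]

variable [hp : Fact p.Prime]

instance (i : Fin p) : NeZero (ord p m i) :=
  ⟨by unfold ord; split_ifs <;> exact pow_ne_zero _ hp.out.ne_zero⟩

theorem ord_nsmul_phiGen (i : Fin p) : ord p m i • phiGen p m i = 0 := by
  have h2 := hp.out.two_le
  by_cases h0 : (i : ℕ) = 0
  · have h1 : ord p m i = p ^ m := by simp [ord, h0]
    rw [h1]
    unfold phiGen
    rw [if_pos (by omega), nsmul_add, pow_nsmul_aN, pow_nsmul_aN, add_zero]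
  · have h1 : ord p m i = p ^ (m - 1) := by simp [ord, h0]
    rw [h1]
    unfold phiGen
    split_ifs
    · rw [nsmul_add, pow_pred_nsmul_aN _ _ _ h0, pow_pred_nsmul_aN _ _ _ (by omega), add_zero]
    · rw [nsmul_sub, pow_pred_nsmul_aN _ _ _ h0, Finset.smul_sum, Finset.sum_eq_zero, sub_zero]
      intro j hj
      rw [Finset.mem_Icc] at hj
      rw [smul_comm, pow_pred_nsmul_aN _ _ _ (by omega), nsmul_zero]

/-- The endomorphism `φ` of `W` with `φ (a i) = phiGen i` for all `i`. -/
noncomputable def phiHom : AddW p m →+ AddW p m :=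
  ∑ i : Fin p, (ZMod.lift (ord p m i)
    ⟨zmultiplesHom (AddW p m) (phiGen p m i), by
      simpa using ord_nsmul_phiGen p m i⟩).comp
    (Pi.evalAddMonoidHom (fun i : Fin p => ZMod (ord p m i)) i)

/-- `φ` as an element of the endomorphism ring of `W`. -/
noncomputable def phiEnd : AddMonoid.End (AddW p m) := phiHom p m

theorem phiEnd_a (i : Fin p) : phiEnd p m (a p m i) = phiGen p m i := by
  change phiHom p m (a p m i) = _
  unfold phiHom a
  rw [AddMonoidHom.finsetSum_apply, Finset.sum_eq_single i]
  · have := ZMod.lift_coe (ord p m i) ⟨zmultiplesHom (AddW p m) (phiGen p m i), by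
      simpa using ord_nsmul_phiGen p m i⟩ 1
    simpa using this
  · intro j _ hj
    simp [hj]
  · simp

/-- Two endomorphisms of `W` that agree on the generators `a i` are equal. -/
theorem hom_ext {f g : AddW p m →+ AddW p m} (h : ∀ i, f (a p m i) = g (a p m i)) : f = g := by
  refine AddMonoidHom.functions_ext (AddW p m) f g fun i x => ?_
  have hx : (Pi.single i x : AddW p m) = x.val • a p m i := by
    unfold a
    rw [← Pi.single_smul]
    simp
  rw [hx, map_nsmul, map_nsmul, h]

theorem end_ext {f g : AddMonoid.End (AddW p m)} (h : ∀ i, f (a p m i) = g (a p m i)) :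
    f = g := hom_ext p m h

theorem phiEnd_aN_of_lt (i : ℕ) (hi : i + 1 < p) :
    (phiEnd p m - 1) (aN p m i) = aN p m (i + 1) := by
  have h1 : aN p m i = a p m ⟨i, by omega⟩ := by simp [aN, show i < p by omega]
  have h2 := phiEnd_a p m ⟨i, by omega⟩
  rw [← h1] at h2
  rw [end_sub_apply, h2]
  simp [phiGen, hi]

theorem phiEnd_aN_last : (phiEnd p m - 1) (aN p m (p - 1)) =
    - ∑ j ∈ Finset.Icc 1 (p - 1), p.choose j • aN p m j := by
  have h0 := hp.out.two_le
  have h1 : aN p m (p - 1) = a p m ⟨p - 1, by omega⟩ := by simp [aN, show p - 1 < p by omega]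
  have h2 := phiEnd_a p m ⟨p - 1, by omega⟩
  rw [← h1] at h2
  rw [end_sub_apply, h2]
  simp [phiGen, show ¬ (p - 1 + 1 < p) by omega]

theorem pow_aN_zero (i : ℕ) (hi : i < p) :
    ((phiEnd p m - 1) ^ i) (aN p m 0) = aN p m i := by
  induction i with
  | zero => simp
  | succ k ih =>
    rw [pow_succ', end_mul_apply, ih (by omega), phiEnd_aN_of_lt _ _ _ hi]

theorem phiEnd_pow : phiEnd p m ^ p = 1 := by
  have h2 := hp.out.two_le
  have key : (phiEnd p m ^ p) (aN p m 0) = aN p m 0 := by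
    have h : phiEnd p m = (phiEnd p m - 1) + 1 := by abel
    have hN : ((phiEnd p m - 1) ^ p) (aN p m 0) =
        - ∑ j ∈ Finset.Icc 1 (p - 1), p.choose j • aN p m j := by
      rw [show (phiEnd p m - 1) ^ p = (phiEnd p m - 1) * (phiEnd p m - 1) ^ (p - 1) by
        rw [← pow_succ']; congr 1; omega, end_mul_apply,
        pow_aN_zero _ _ _ (by omega), phiEnd_aN_last]
    have hsum : ∑ j ∈ Finset.range p, p.choose j • aN p m j =
        aN p m 0 + ∑ j ∈ Finset.Icc 1 (p - 1), p.choose j • aN p m j := by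
      have : Finset.range p = insert 0 (Finset.Icc 1 (p - 1)) := by
        ext x; simp only [Finset.mem_range, Finset.mem_insert, Finset.mem_Icc]; omega
      rw [this, Finset.sum_insert (by simp)]
      simp
    conv_lhs => rw [h, (Commute.one_right (phiEnd p m - 1)).add_pow]
    rw [end_sum_apply, Finset.sum_range_succ]
    have hterm : ∀ j ∈ Finset.range p,
        ((phiEnd p m - 1) ^ j * 1 ^ (p - j) * (p.choose j : AddMonoid.End (AddW p m)))
          (aN p m 0) = p.choose j • aN p m j := by
      intro j hj
      rw [one_pow, mul_one, end_mul_apply, AddMonoid.End.natCast_apply, map_nsmul,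
        pow_aN_zero _ _ _ (Finset.mem_range.1 hj)]
    rw [Finset.sum_congr rfl hterm, hsum]
    simp [hN]
  refine end_ext p m fun i => ?_
  have hi : a p m i = ((phiEnd p m - 1) ^ (i : ℕ)) (aN p m 0) := by
    rw [pow_aN_zero _ _ _ i.2]; simp [aN]
  have hc : Commute (phiEnd p m ^ p) ((phiEnd p m - 1) ^ (i : ℕ)) :=
    (Commute.sub_right (Commute.refl _) (Commute.one_right _)).pow_pow _ _
  rw [hi, ← end_mul_apply, hc.eq, end_mul_apply, key]
  rfl

/-- The group `W`, written multiplicatively. -/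
abbrev W : Type := Multiplicative (AddW p m)

/-- `φ` as an automorphism of `W`. -/
noncomputable def phi : MulAut (W p m) :=
  AddEquiv.toMultiplicative
    (AddMonoidHom.toAddEquiv (phiEnd p m) (phiEnd p m ^ (p - 1))
      (by
        have h : phiEnd p m ^ (p - 1) * phiEnd p m = 1 := by
          rw [← pow_succ, Nat.sub_add_cancel hp.out.one_le, phiEnd_pow]
        exact h)
      (by
        have h : phiEnd p m * phiEnd p m ^ (p - 1) = 1 := by
          rw [← pow_succ', Nat.sub_add_cancel hp.out.one_le, phiEnd_pow]
        exact h))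

theorem phi_ofAdd (x : AddW p m) :
    phi p m (Multiplicative.ofAdd x) = Multiplicative.ofAdd (phiEnd p m x) := rfl

theorem phi_pow_apply (k : ℕ) (x : AddW p m) :
    (phi p m ^ k) (Multiplicative.ofAdd x) = Multiplicative.ofAdd ((phiEnd p m ^ k) x) := by
  induction k with
  | zero => rfl
  | succ k ih => rw [pow_succ', pow_succ', MulAut.mul_apply, ih, phi_ofAdd]; rfl

theorem phi_pow : phi p m ^ p ^ (m - 1) = 1 := by
  rcases Nat.eq_zero_or_pos (m - 1) with h | h
  · -- here every `a j` with `j ≠ 0` is trivial, so that `φ` is the identity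
    have hz : ∀ j, j ≠ 0 → aN p m j = 0 := fun j hj => by
      have := pow_pred_nsmul_aN p m j hj
      rwa [h, pow_zero, one_nsmul] at this
    have h1 : phiEnd p m = 1 := by
      refine end_ext p m fun i => ?_
      rw [phiEnd_a]
      have hi : aN p m i = a p m i := by simp [aN]
      unfold phiGen
      split_ifs
      · rw [hz _ (Nat.succ_ne_zero _), add_zero, hi]; rfl
      · rw [Finset.sum_eq_zero, sub_zero, hi]
        · rfl
        · intro j hj
          rw [hz j (by rw [Finset.mem_Icc] at hj; omega), nsmul_zero]
    ext1 x
    rw [← ofAdd_toAdd x, phi_pow_apply, h1, one_pow]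
    rfl
  · obtain ⟨c, hc⟩ := dvd_pow_self p h.ne'
    ext1 x
    rw [← ofAdd_toAdd x, phi_pow_apply, hc, pow_mul, phiEnd_pow, one_pow]
    rfl

/-- The cyclic group `⟨b₀⟩` of order `p ^ (m - 1)`. -/
abbrev B : Type := Multiplicative (ZMod (p ^ (m - 1)))

/-- The action of `⟨b₀⟩` on `W` for which the generator `b₀` acts as `φ⁻¹`. In the semidirect
product this means `b₀ * w * b₀⁻¹ = φ⁻¹ w`, that is, `b₀⁻¹ * w * b₀ = φ w`. -/
noncomputable def act : B p m →* MulAut (W p m) :=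
  AddMonoidHom.toMultiplicativeLeft
    (ZMod.lift (p ^ (m - 1))
      ⟨zmultiplesHom (Additive (MulAut (W p m))) (Additive.ofMul (phi p m)⁻¹), by
        have h : ((phi p m)⁻¹) ^ p ^ (m - 1) = 1 := by rw [inv_pow, phi_pow, inv_one]
        rw [zmultiplesHom_apply, natCast_zsmul, ← ofMul_pow, h, ofMul_one]⟩)

theorem act_gen : act p m (Multiplicative.ofAdd 1) = (phi p m)⁻¹ := by
  have := ZMod.lift_coe (p ^ (m - 1))
      ⟨zmultiplesHom (Additive (MulAut (W p m))) (Additive.ofMul (phi p m)⁻¹), by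
        have h : ((phi p m)⁻¹) ^ p ^ (m - 1) = 1 := by rw [inv_pow, phi_pow, inv_one]
        rw [zmultiplesHom_apply, natCast_zsmul, ← ofMul_pow, h, ofMul_one]⟩ 1
  simp only [Int.cast_one, zmultiplesHom_apply, one_smul] at this
  exact this

/-- The semidirect product `U = W ⋊ ⟨b₀⟩`. -/
abbrev U : Type := W p m ⋊[act p m] B p m

instance : Finite (U p m) :=
  haveI : NeZero (p ^ (m - 1)) := ⟨pow_ne_zero _ hp.out.ne_zero⟩
  haveI : Finite (B p m) := inferInstanceAs (Finite (ZMod (p ^ (m - 1))))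
  haveI : Finite (W p m) := inferInstanceAs (Finite (AddW p m))
  Finite.of_equiv _ SemidirectProduct.equivProd.symm

/-- The element `a j` of `U` (for `j < p`). -/
noncomputable def aU (j : ℕ) : U p m := SemidirectProduct.inl (Multiplicative.ofAdd (aN p m j))

/-- The element `b₀` of `U`. -/
noncomputable def bU : U p m := SemidirectProduct.inr (Multiplicative.ofAdd 1)

/-- The defining relation `b₀⁻¹ * w * b₀ = φ w` for `w ∈ W`. -/
theorem bU_inv_mul_mul (w : W p m) :
    (bU p m)⁻¹ * SemidirectProduct.inl w * bU p m = SemidirectProduct.inl (phi p m w) := by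
  have h := SemidirectProduct.inl_aut_inv (φ := act p m) (Multiplicative.ofAdd 1) w
  rw [act_gen, inv_inv] at h
  rw [h]
  simp [bU]

/-- The generator `a₀ ^ (p ^ (m - 1)) * a_{p - 1} ^ (p ^ (m - 2))` of `D`. -/
noncomputable def dU : U p m := aU p m 0 ^ p ^ (m - 1) * aU p m (p - 1) ^ p ^ (m - 2)

theorem nsmul_eq_zero_of_sum : p ^ (m - 2) •
    (- ∑ j ∈ Finset.Icc 1 (p - 1), p.choose j • aN p m j) = 0 := by
  rw [smul_neg, Finset.smul_sum, Finset.sum_eq_zero, neg_zero]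
  intro j hj
  rw [Finset.mem_Icc] at hj
  obtain ⟨c, hc⟩ := hp.out.dvd_choose_self (k := j) (by omega) (by omega)
  obtain ⟨d, hd⟩ : p ^ (m - 1) ∣ p ^ (m - 2) * p := by
    rw [← pow_succ]; exact pow_dvd_pow _ (by omega)
  rw [smul_smul, hc, ← mul_assoc, hd, mul_assoc, mul_comm, mul_smul,
    pow_pred_nsmul_aN _ _ _ (by omega), smul_zero]

theorem phiEnd_d : phiEnd p m (p ^ (m - 1) • aN p m 0 + p ^ (m - 2) • aN p m (p - 1)) =
    p ^ (m - 1) • aN p m 0 + p ^ (m - 2) • aN p m (p - 1) := by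
  have h2 := hp.out.two_le
  have h0 : (phiEnd p m - 1) (p ^ (m - 1) • aN p m 0 + p ^ (m - 2) • aN p m (p - 1)) = 0 := by
    rw [map_add, map_nsmul, map_nsmul, phiEnd_aN_of_lt _ _ _ (by omega), phiEnd_aN_last,
      pow_pred_nsmul_aN _ _ _ (by omega), zero_add, nsmul_eq_zero_of_sum]
  rw [end_sub_apply] at h0
  exact sub_eq_zero.1 h0

theorem dU_eq : dU p m = SemidirectProduct.inl (Multiplicative.ofAdd
    (p ^ (m - 1) • aN p m 0 + p ^ (m - 2) • aN p m (p - 1))) := by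
  rw [dU, aU, aU, ← MonoidHom.map_pow, ← MonoidHom.map_pow, ← MonoidHom.map_mul]
  rfl

theorem act_fix (w : W p m) (hw : phi p m w = w) (g : B p m) : act p m g w = w := by
  have hg : g = (Multiplicative.ofAdd 1) ^ (ZMod.cast (Multiplicative.toAdd g) : ℤ) := by
    apply Multiplicative.toAdd.injective
    simp
  have hmem : (phi p m)⁻¹ ∈ MulAction.stabilizer (MulAut (W p m)) w :=
    inv_mem (show phi p m ∈ MulAction.stabilizer (MulAut (W p m)) w from hw)
  rw [hg, map_zpow, act_gen]
  exact zpow_mem hmem _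

theorem dU_central (u : U p m) : u * dU p m = dU p m * u := by
  rw [dU_eq]
  have hw := act_fix p m (Multiplicative.ofAdd
    (p ^ (m - 1) • aN p m 0 + p ^ (m - 2) • aN p m (p - 1)))
    (by rw [phi_ofAdd, phiEnd_d]) u.right
  ext1
  · rw [SemidirectProduct.mul_left, SemidirectProduct.mul_left, SemidirectProduct.left_inl,
      SemidirectProduct.right_inl, hw, map_one, MulAut.one_apply, mul_comm]
  · simp

/-- The subgroup `D` of `U`. -/
noncomputable def D : Subgroup (U p m) := Subgroup.zpowers (dU p m)

instance : (D p m).Normal where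
  conj_mem n hn g := by
    have h : Commute g n := by
      obtain ⟨k, rfl⟩ := Subgroup.mem_zpowers_iff.1 hn
      exact Commute.zpow_right (show Commute g (dU p m) from dU_central p m g) k
    rwa [h.eq, mul_inv_cancel_right]

end Construction

end ExpCrit

namespace ExpCrit

/-! Let `P` be of type A with abelian maximal subgroup `A`. Exponent-criticality says that a proper
subgroup containing an element of order `p ^ m` is abelian, so `A` is the only maximal subgroup that
contains such elements. Take `x` of order `p ^ m`, necessarily in `A`, and `b` outside `A`. No
maximal subgroup contains both, so they generate `P`. The commutator of `b` and `x` lies in every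
maximal subgroup, in particular in one through `b`, so its order divides `p ^ (m - 1)`. The same
holds for the orders of `b` and `b * x`.

Let `θ` be conjugation by `b` on `A`. Since `b ^ p` is in `A`, `θ ^ p = 1`, and `(b * x) ^ p` is `b
^ p` times the norm of `x`. Expanding the norm in powers of `θ - 1` turns `(b * x) ^ p ^ (m - 1) =
1` into the relation that defines `D` (`mul_prime_pow_eq`). Hence `P` satisfies the relations of `U
/ D` and is a quotient of it (`IsTypeA.exists_surjective`).

Conversely, in `U / D` let `A` be generated by `W` and `b₀ ^ p`. The same norm formula gives every
element outside `A` order dividing `p ^ (m - 1)`, and an element of order `p ^ m` shares no maximal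
subgroup with an element outside `A` (`not_isCoatom_of_mem`). So proper non-abelian subgroups have
smaller exponent. Comparing orders finishes the proof. -/

theorem geom_sum_add_one {R : Type*} [Ring R] (N : R) (n : ℕ) :
    ∑ i ∈ Finset.range n, (N + 1) ^ i = ∑ j ∈ Finset.range n, (n.choose (j + 1) : R) * N ^ j := by
  have h := congrArg (Polynomial.aeval (R := ℤ) N)
    (Polynomial.geom_sum_X_comp_X_add_one_eq_sum (R := ℤ) n)
  simpa [Polynomial.aeval_comp] using h

/-! ### Norms, powers in a cyclic extension, and homomorphisms out of `U` -/

section Norm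

variable {V : Type*} [AddCommGroup V]

theorem End.sum_apply {ι : Type*} (s : Finset ι) (f : ι → AddMonoid.End V) (x : V) :
    (∑ j ∈ s, f j) x = ∑ j ∈ s, f j x :=
  map_sum (AddMonoidHom.eval x : (V →+ V) →+ V) f s

theorem End.mul_apply (f g : AddMonoid.End V) (x : V) : (f * g) x = f (g x) := rfl

theorem End.sub_apply (f g : AddMonoid.End V) (x : V) : (f - g) x = f x - g x := rfl

theorem End.nsmul_pow_apply_eq_zero (N : AddMonoid.End V) (k : ℕ) {x : V} {n : ℕ} (h : n • x = 0) :
    n • (N ^ k) x = 0 := by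
  rw [← map_nsmul, h, map_zero]

/-- If `θ - 1` maps `x` to an element killed by `p ^ (m - 1)`, the multiple by `p ^ (m - 2)` of the
norm of `x` reduces to the first and the last term of its expansion in powers of `θ - 1`. -/
theorem pow_nsmul_norm (p m : ℕ) [hp : Fact p.Prime] (hm : 2 ≤ m) (θ : AddMonoid.End V) (x : V)
    (hx : p ^ (m - 1) • (θ - 1) x = 0) :
    p ^ (m - 2) • (∑ i ∈ Finset.range p, θ ^ i) x =
      p ^ (m - 1) • x + p ^ (m - 2) • ((θ - 1) ^ (p - 1)) x := by
  have h2 := hp.out.two_le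
  obtain ⟨n, rfl⟩ : ∃ n, m = n + 2 := ⟨m - 2, by omega⟩
  obtain ⟨q, rfl⟩ : ∃ q, p = q + 2 := ⟨p - 2, by omega⟩
  simp only [Nat.add_sub_cancel, show n + 2 - 1 = n + 1 by omega,
    show q + 2 - 1 = q + 1 by omega] at hx ⊢
  have h := geom_sum_add_one (θ - 1) (q + 2)
  rw [sub_add_cancel] at h
  rw [h, Finset.sum_range_succ, Finset.sum_range_succ']
  -- A middle binomial coefficient supplies one more factor `p`, and a factor `θ - 1` is still
  -- present, so `hx` kills these terms.
  have hmid : (q + 2) ^ n • (∑ k ∈ Finset.range q,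
      ((q + 2).choose (k + 1 + 1) : AddMonoid.End V) * (θ - 1) ^ (k + 1)) x = 0 := by
    rw [End.sum_apply, Finset.smul_sum]
    refine Finset.sum_eq_zero fun k hk => ?_
    rw [Finset.mem_range] at hk
    obtain ⟨c, hc⟩ := hp.out.dvd_choose_self (k := k + 1 + 1) (by omega) (by omega)
    rw [End.mul_apply, AddMonoid.End.natCast_apply, hc, smul_smul, ← mul_assoc,
      ← pow_succ, mul_comm, mul_smul,
      show ((θ - 1) ^ (k + 1)) x = ((θ - 1) ^ k) ((θ - 1) x) by rw [pow_succ, End.mul_apply],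
      End.nsmul_pow_apply_eq_zero _ _ hx, smul_zero]
  change (q + 2) ^ n • ((∑ k ∈ Finset.range q,
      ((q + 2).choose (k + 1 + 1) : AddMonoid.End V) * (θ - 1) ^ (k + 1)) x +
    (((q + 2).choose (0 + 1) : AddMonoid.End V) * (θ - 1) ^ 0 : AddMonoid.End V) x +
    (((q + 2).choose (q + 1 + 1) : AddMonoid.End V) * (θ - 1) ^ (q + 1)) x) = _
  rw [smul_add, smul_add, hmid, zero_add]
  simp only [zero_add, Nat.choose_one_right, pow_zero, mul_one, Nat.choose_self, Nat.cast_one,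
    one_mul, AddMonoid.End.natCast_apply, smul_smul, ← pow_succ]

variable {G : Type*} [Group G] {f : Multiplicative V →* G} {θ : AddMonoid.End V} {b : G}

/-- Moving every `b` to the left replaces the copies of `x` by their conjugates `θ ^ i x`. -/
theorem mul_pow_eq_pow_mul_norm
    (hb : ∀ v, b⁻¹ * f (Multiplicative.ofAdd v) * b = f (Multiplicative.ofAdd (θ v)))
    (x : V) (n : ℕ) : (b * f (Multiplicative.ofAdd x)) ^ n =
      b ^ n * f (Multiplicative.ofAdd ((∑ i ∈ Finset.range n, θ ^ i) x)) := by
  induction n with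
  | zero => simp [show (0 : AddMonoid.End V) x = 0 from rfl]
  | succ n ih =>
    have h1 : (∑ i ∈ Finset.range (n + 1), θ ^ i) x =
        θ ((∑ i ∈ Finset.range n, θ ^ i) x) + x := by
      rw [Finset.sum_range_succ', ← End.mul_apply, Finset.mul_sum]
      simp only [← pow_succ']
      rfl
    rw [pow_succ, ih, h1, ofAdd_add, map_mul, ← hb, pow_succ]
    group

theorem apply_pow_eq_conj
    (hb : ∀ v, b⁻¹ * f (Multiplicative.ofAdd v) * b = f (Multiplicative.ofAdd (θ v)))
    (k : ℕ) (v : V) : f (Multiplicative.ofAdd ((θ ^ k) v)) =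
      (b ^ k)⁻¹ * f (Multiplicative.ofAdd v) * b ^ k := by
  induction k with
  | zero => simp
  | succ k ih => rw [pow_succ', End.mul_apply, ← hb, ih, pow_succ]; group

/-- The `p`-th power is `b ^ p` times a norm, and these two factors commute, so the remaining power
`p ^ (m - 2)` splits. The second factor on the right has the shape of the generator of `D`. -/
theorem mul_prime_pow_eq (p m : ℕ) [hp : Fact p.Prime] (hm : 2 ≤ m)
    (hb : ∀ v, b⁻¹ * f (Multiplicative.ofAdd v) * b = f (Multiplicative.ofAdd (θ v)))
    (hbp : ∀ v, Commute (b ^ p) (f v)) (x : V) (hx : p ^ (m - 1) • (θ - 1) x = 0) :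
    (b * f (Multiplicative.ofAdd x)) ^ p ^ (m - 1) = b ^ p ^ (m - 1) *
      f (Multiplicative.ofAdd (p ^ (m - 1) • x + p ^ (m - 2) • ((θ - 1) ^ (p - 1)) x)) := by
  have h : p ^ (m - 1) = p * p ^ (m - 2) := by rw [← pow_succ']; congr 1; omega
  rw [← pow_nsmul_norm p m hm θ x hx, h, pow_mul, mul_pow_eq_pow_mul_norm hb, (hbp _).mul_pow,
    ← pow_mul, ofAdd_nsmul, map_pow]

/-- This is `(θ - 1) * ∑ θ ^ i = θ ^ p - 1 = 0`, expanded in powers of `θ - 1` and solved for the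
top one. It explains the formula for `φ` on the last generator. -/
theorem sub_one_pow_prime_apply (p : ℕ) (hp : 0 < p) (hθ : θ ^ p = 1) (x : V) :
    ((θ - 1) ^ p) x = -∑ j ∈ Finset.Icc 1 (p - 1), p.choose j • ((θ - 1) ^ j) x := by
  obtain ⟨q, rfl⟩ : ∃ q, p = q + 1 := ⟨p - 1, by omega⟩
  have h : (θ - 1) * ∑ i ∈ Finset.range (q + 1), (θ - 1 + 1) ^ i = 0 := by
    rw [sub_add_cancel, mul_geom_sum, hθ, sub_self]
  rw [geom_sum_add_one, Finset.mul_sum] at h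
  have h1 (j : ℕ) : ((θ - 1) * (((q + 1).choose (j + 1) : AddMonoid.End V) * (θ - 1) ^ j)) x =
      (q + 1).choose (j + 1) • ((θ - 1) ^ (j + 1)) x := by
    rw [← mul_assoc, ← (Nat.cast_commute _ _).eq, mul_assoc, ← pow_succ']
    exact AddMonoid.End.natCast_apply _ _
  have h2 := congrArg (fun e : AddMonoid.End V => e x) h
  rw [End.sum_apply, Finset.sum_range_succ, h1, Nat.choose_self, one_smul,
    Finset.sum_congr rfl fun j _ => h1 j, Finset.range_eq_Ico,
    Finset.sum_Ico_add' (fun j => (q + 1).choose j • ((θ - 1) ^ j) x)] at h2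
  have h3 : Finset.Icc 1 (q + 1 - 1) = Finset.Ico (0 + 1) (q + 1) := by
    ext; simp only [Finset.mem_Icc, Finset.mem_Ico]; omega
  rw [h3, eq_neg_iff_add_eq_zero, add_comm]
  exact h2

/-- Two homomorphisms on `W` that agree on the generators `a i` are equal. -/
theorem addW_hom_ext (p m : ℕ) [Fact p.Prime] {g h : AddW p m →+ V}
    (H : ∀ i, g (a p m i) = h (a p m i)) : g = h := by
  refine AddMonoidHom.functions_ext V g h fun i x => ?_
  have hx : (Pi.single i x : AddW p m) = x.val • a p m i := by
    unfold a
    rw [← Pi.single_smul]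
    simp
  rw [hx, map_nsmul, map_nsmul, H]

theorem exists_eq_ofAdd_one_pow (p m : ℕ) [hp : Fact p.Prime] (k : B p m) :
    ∃ n : ℕ, k = Multiplicative.ofAdd 1 ^ n := by
  have : NeZero (p ^ (m - 1)) := ⟨pow_ne_zero _ hp.out.ne_zero⟩
  refine ⟨ZMod.val (Multiplicative.toAdd k), ?_⟩
  apply Multiplicative.toAdd.injective
  simp

/-- The universal property of `U`. -/
theorem exists_hom_of_relations (p m : ℕ) [hp : Fact p.Prime]
    (hb : ∀ v, b⁻¹ * f (Multiplicative.ofAdd v) * b = f (Multiplicative.ofAdd (θ v)))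
    (hθ : θ ^ p = 1) (hbo : b ^ p ^ (m - 1) = 1) (x : V) (hx0 : p ^ m • x = 0)
    (hx : p ^ (m - 1) • (θ - 1) x = 0) :
    ∃ F : U p m →* G, F (bU p m) = b ∧ ∀ i < p,
      F (aU p m i) = f (Multiplicative.ofAdd (((θ - 1) ^ i) x)) := by
  have h2 := hp.out.two_le
  have hord (i : Fin p) : ord p m i • ((θ - 1) ^ (i : ℕ)) x = 0 := by
    unfold ord
    split_ifs with h
    · exact End.nsmul_pow_apply_eq_zero _ _ hx0
    · obtain ⟨k, hk⟩ : ∃ k, (i : ℕ) = k + 1 := ⟨i - 1, by omega⟩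
      rw [hk, pow_succ, End.mul_apply, End.nsmul_pow_apply_eq_zero _ _ hx]
  let g : AddW p m →+ V := ∑ i : Fin p, (ZMod.lift (ord p m i)
    ⟨zmultiplesHom V (((θ - 1) ^ (i : ℕ)) x), by simpa using hord i⟩).comp
    (Pi.evalAddMonoidHom (fun i : Fin p => ZMod (ord p m i)) i)
  have hga (i : Fin p) : g (a p m i) = ((θ - 1) ^ (i : ℕ)) x := by
    simp only [g, a]
    rw [AddMonoidHom.finsetSum_apply, Finset.sum_eq_single i]
    · have := ZMod.lift_coe (ord p m i)
        ⟨zmultiplesHom V (((θ - 1) ^ (i : ℕ)) x), by simpa using hord i⟩ 1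
      simpa using this
    · intro j _ hj
      simp [hj]
    · simp
  have hgaN (i : ℕ) (hi : i < p) : g (aN p m i) = ((θ - 1) ^ i) x := by
    simpa [aN, hi] using hga ⟨i, hi⟩
  -- It is enough to compare `φ - 1` with `θ - 1` on generators: both shift the index, and at the
  -- last one `hθ` gives the same binomial relation.
  have hgφ : g.comp (phiHom p m) = (θ : V →+ V).comp g := by
    refine addW_hom_ext p m fun i => ?_
    change g (phiEnd p m (a p m i)) = θ (g (a p m i))
    have hN : g ((phiEnd p m - 1) (a p m i)) = (θ - 1) (g (a p m i)) := by
      have hai : a p m i = aN p m i := by simp [aN]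
      rw [hga, ← End.mul_apply, ← pow_succ', hai]
      rcases lt_or_ge ((i : ℕ) + 1) p with hi | hi
      · rw [phiEnd_aN_of_lt _ _ _ hi, hgaN _ hi]
      · rw [show (i : ℕ) = p - 1 by omega, phiEnd_aN_last, Nat.sub_add_cancel (by omega),
          sub_one_pow_prime_apply p (by omega) hθ, map_neg, map_sum]
        congr 1
        refine Finset.sum_congr rfl fun j hj => ?_
        rw [Finset.mem_Icc] at hj
        rw [map_nsmul, hgaN _ (by omega)]
    rw [end_sub_apply, End.sub_apply, map_sub] at hN
    exact sub_left_injective hN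
  let fB : B p m →* G := AddMonoidHom.toMultiplicativeLeft
    (ZMod.lift (p ^ (m - 1)) ⟨zmultiplesHom (Additive G) (Additive.ofMul b), by
      rw [zmultiplesHom_apply, natCast_zsmul, ← ofMul_pow, hbo, ofMul_one]⟩)
  have hfB : fB (Multiplicative.ofAdd 1) = b := by
    have := ZMod.lift_coe (p ^ (m - 1)) ⟨zmultiplesHom (Additive G) (Additive.ofMul b), by
      rw [zmultiplesHom_apply, natCast_zsmul, ← ofMul_pow, hbo, ofMul_one]⟩ 1
    simp only [Int.cast_one, zmultiplesHom_apply, one_smul] at this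
    exact this
  let fW : W p m →* G := f.comp (AddMonoidHom.toMultiplicative g)
  have hgen (w : W p m) : b⁻¹ * fW w * b = fW (phi p m w) := by
    refine (hb (g w.toAdd)).trans ?_
    exact congrArg (fun v => f (Multiplicative.ofAdd v)) (DFunLike.congr_fun hgφ w.toAdd).symm
  have hcompat (k : B p m) : fW.comp (act p m k).toMonoidHom =
      (MulAut.conj (fB k)).toMonoidHom.comp fW := by
    obtain ⟨n, rfl⟩ := exists_eq_ofAdd_one_pow p m k
    induction n with
    | zero => ext; simp
    | succ n ih =>
      refine MonoidHom.ext fun w => ?_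
      -- The generator acts as `φ⁻¹`, so the induction hypothesis is needed at `φ⁻¹ w`.
      have h := DFunLike.congr_fun ih ((phi p m)⁻¹ w)
      have h' := hgen ((phi p m)⁻¹ w)
      rw [← MulAut.mul_apply, mul_inv_cancel, MulAut.one_apply] at h'
      change fW (act p m (Multiplicative.ofAdd 1 ^ n) _) =
        fB (Multiplicative.ofAdd 1 ^ n) * _ * (fB (Multiplicative.ofAdd 1 ^ n))⁻¹ at h
      change fW (act p m (Multiplicative.ofAdd 1 ^ (n + 1)) w) =
        fB (Multiplicative.ofAdd 1 ^ (n + 1)) * fW w * (fB (Multiplicative.ofAdd 1 ^ (n + 1)))⁻¹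
      rw [map_pow, act_gen, map_pow, hfB] at h ⊢
      rw [pow_succ, MulAut.mul_apply, pow_succ]
      rw [h, ← h']
      group
  refine ⟨SemidirectProduct.lift fW fB hcompat, ?_, fun i hi => ?_⟩
  · rw [bU, SemidirectProduct.lift_inr, hfB]
  · rw [aU, SemidirectProduct.lift_inl, ← hgaN i hi]
    rfl

end Norm

/-! ### Maximal subgroups of finite `p`-groups -/

section PGroup

variable {p : ℕ} [hp : Fact p.Prime] {G : Type*} [Group G] [Finite G]

theorem normal_of_isCoatom (hG : IsPGroup p G) {M : Subgroup G} (hM : IsCoatom M) : M.Normal :=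
  have := hG.isNilpotent
  Subgroup.NormalizerCondition.normal_of_coatom M Group.normalizerCondition_of_isNilpotent hM

theorem index_of_isCoatom (hG : IsPGroup p G) {M : Subgroup G} (hM : IsCoatom M) :
    M.index = p := by
  obtain ⟨n, hn⟩ := (hG.to_subgroup M).exists_card_eq
  obtain ⟨N, hN⟩ := hG.exists_card_eq
  have hlt : n < N := by
    by_contra! hle
    refine hM.1 (M.eq_top_of_le_card ?_)
    rw [hn, hN]
    exact Nat.pow_le_pow_right hp.out.pos hle
  obtain ⟨K, hK, hMK⟩ := Sylow.exists_subgroup_card_pow_succ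
    (hN ▸ pow_dvd_pow p hlt : p ^ (n + 1) ∣ Nat.card G) hn
  have hne : M ≠ K := by
    rintro rfl
    rw [hn] at hK
    exact absurd (Nat.pow_right_injective hp.out.two_le hK) (by omega)
  rw [hM.2 K (lt_of_le_of_ne hMK hne), Subgroup.card_top] at hK
  have h := M.card_mul_index
  rw [hn, hK, pow_succ] at h
  exact Nat.eq_of_mul_eq_mul_left (pow_pos hp.out.pos n) h

theorem pow_mem_of_isCoatom (hG : IsPGroup p G) {M : Subgroup G} (hM : IsCoatom M) (g : G) :
    g ^ p ∈ M := by
  have := normal_of_isCoatom hG hM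
  exact index_of_isCoatom hG hM ▸ M.pow_index_mem g

theorem commutator_mem_of_isCoatom (hG : IsPGroup p G) {M : Subgroup G} (hM : IsCoatom M)
    (x y : G) : x⁻¹ * y * x * y⁻¹ ∈ M := by
  have := normal_of_isCoatom hG hM
  have hcard : Nat.card (G ⧸ M) = p := index_of_isCoatom hG hM
  have := isCyclic_of_prime_card hcard
  let _ : CommGroup (G ⧸ M) := IsCyclic.commGroup
  rw [← QuotientGroup.eq_one_iff]
  simp

theorem exists_le_isCoatom {H : Subgroup G} (hH : H ≠ ⊤) : ∃ M, IsCoatom M ∧ H ≤ M :=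
  (eq_top_or_exists_le_coatom H).resolve_left hH

end PGroup

/-! ### Every group of type A is a quotient of `U / D` -/

/-- A non-abelian such `H` would by itself contribute `p ^ m` to the least common multiple, which
always divides the exponent. -/
theorem IsTypeA.isMulCommutative_of_orderOf {p m : ℕ} {P : Type*} [Group P] [Finite P]
    (hP : IsTypeA p m P) {H : Subgroup P} (hH : H ≠ ⊤) {x : P} (hx : x ∈ H)
    (hox : orderOf x = p ^ m) : IsMulCommutative H := by
  by_contra hc
  refine hP.exponentCritical (Nat.dvd_antisymm ?_ ?_)
  · refine Dvd.dvd.trans ?_ (Finset.dvd_lcm (b := H) (by simp [hH, hc]))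
    rw [hP.exponent_eq, ← hox, ← Subgroup.orderOf_mk x hx]
    exact Monoid.order_dvd_exponent _
  · exact Finset.lcm_dvd fun K _ => Monoid.exponent_dvd_of_monoidHom K.subtype K.subtype_injective

theorem IsTypeA.pow_eq_one {p m : ℕ} [hp : Fact p.Prime] {P : Type*} [Group P] [Finite P]
    (hP : IsTypeA p m P) {x : P} (hx : orderOf x ≠ p ^ m) : x ^ p ^ (m - 1) = 1 := by
  have h : orderOf x ∣ p ^ m := hP.exponent_eq ▸ Monoid.order_dvd_exponent x
  obtain ⟨k, hk, hxk⟩ := (Nat.dvd_prime_pow hp.out).1 h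
  rw [← orderOf_dvd_iff_pow_eq_one, hxk]
  refine pow_dvd_pow _ ?_
  have : k ≠ m := by rintro rfl; exact hx hxk
  omega

theorem IsTypeA.exists_orderOf_eq {p m : ℕ} [hp : Fact p.Prime] {P : Type*} [Group P] [Finite P]
    (hP : IsTypeA p m P) (hm : 1 ≤ m) : ∃ x : P, orderOf x = p ^ m := by
  by_contra! h
  have h1 : Monoid.exponent P ∣ p ^ (m - 1) :=
    Monoid.exponent_dvd_of_forall_pow_eq_one fun x => hP.pow_eq_one (h x)
  rw [hP.exponent_eq, Nat.pow_dvd_pow_iff_le_right hp.out.one_lt] at h1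
  omega

open scoped IsMulCommutative in
theorem IsTypeA.exists_surjective {p m : ℕ} [hp : Fact p.Prime] (hm : 2 ≤ m) {P : Type*} [Group P]
    [Finite P] (hP : IsTypeA p m P) :
    ∃ f : (U p m ⧸ D p m) →* P, Function.Surjective f := by
  obtain ⟨A, ⟨hA, hAc⟩, huniq⟩ := hP.typeA
  obtain ⟨x, hx⟩ := hP.exists_orderOf_eq (by omega)
  have hAn := normal_of_isCoatom hP.isPGroup hA
  -- the elements of order `p ^ m` lie in no maximal subgroup but `A`
  have hmem {M : Subgroup P} (hM : IsCoatom M) {y : P} (hy : y ∈ M) (hoy : orderOf y = p ^ m) :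
      M = A :=
    huniq M ⟨hM, hP.isMulCommutative_of_orderOf hM.1 hy hoy⟩
  have hcyc (y : P) : Subgroup.zpowers y ≠ ⊤ := by
    intro h
    refine hP.nonabelian (isMulCommutative_iff.2 fun u v => ?_)
    obtain ⟨k, rfl⟩ := Subgroup.mem_zpowers_iff.1 (h ▸ Subgroup.mem_top u)
    obtain ⟨l, rfl⟩ := Subgroup.mem_zpowers_iff.1 (h ▸ Subgroup.mem_top v)
    rw [← zpow_add, ← zpow_add, add_comm]
  have hxA : x ∈ A := by
    obtain ⟨M, hM, hxM⟩ := exists_le_isCoatom (hcyc x)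
    have hxM := hxM (Subgroup.mem_zpowers x)
    exact hmem hM hxM hx ▸ hxM
  have hnot {y : P} (hy : y ∉ A) : y ^ p ^ (m - 1) = 1 := by
    refine hP.pow_eq_one fun hoy => hy ?_
    obtain ⟨M, hM, hyM⟩ := exists_le_isCoatom (hcyc y)
    have hyM := hyM (Subgroup.mem_zpowers y)
    exact hmem hM hyM hoy ▸ hyM
  obtain ⟨b, hbA⟩ : ∃ b, b ∉ A := by
    by_contra! h
    exact hA.1 (eq_top_iff.2 fun y _ => h y)
  have hbp : b ^ p ∈ A := pow_mem_of_isCoatom hP.isPGroup hA b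
  -- The commutator lies in a maximal subgroup through `b`; order `p ^ m` would force that subgroup
  -- to be `A`.
  have hcomm : (b⁻¹ * x * b * x⁻¹) ^ p ^ (m - 1) = 1 := by
    refine hP.pow_eq_one fun ho => hbA ?_
    obtain ⟨M, hM, hbM⟩ := exists_le_isCoatom (hcyc b)
    have h := hmem hM (commutator_mem_of_isCoatom hP.isPGroup hM b x) ho
    exact h ▸ hbM (Subgroup.mem_zpowers b)
  let V := Additive A
  let f : Multiplicative V →* P := 
    AddMonoidHom.toMultiplicativeLeft (MonoidHom.toAdditive A.subtype)
  let θ : AddMonoid.End V := MonoidHom.toAdditive (MulAut.conjNormal b⁻¹ : MulAut A).toMonoidHom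
  have hf (v : V) : f (Multiplicative.ofAdd v) = (Additive.toMul v : A) := rfl
  have hfinj : Function.Injective f := Subtype.val_injective
  have hb (v : V) : b⁻¹ * f (Multiplicative.ofAdd v) * b = f (Multiplicative.ofAdd (θ v)) := by
    have : ((MulAut.conjNormal b⁻¹ : MulAut A) (Additive.toMul v) : P) =
      b⁻¹ * (Additive.toMul v : A) * b := by simp
    exact this.symm
  have hbc (v : Multiplicative V) : Commute (b ^ p) (f v) :=
    setLike_mul_comm hbp (Subtype.coe_prop (Additive.toMul v.toAdd))
  have hθ : θ ^ p = 1 := by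
    refine AddMonoidHom.ext fun v => Multiplicative.ofAdd.injective (hfinj ?_)
    refine (apply_pow_eq_conj hb p v).trans ?_
    rw [mul_assoc, ← (hbc _).eq, inv_mul_cancel_left]
    rfl
  have hsmul (n : ℕ) (v : V) : n • v = 0 ↔ f (Multiplicative.ofAdd v) ^ n = 1 := by
    rw [← map_pow, ← ofAdd_nsmul, map_eq_one_iff f hfinj, ofAdd_eq_one]
  let x' : V := Additive.ofMul ⟨x, hxA⟩
  have hx0 : p ^ m • x' = 0 := by
    rw [hsmul]
    exact hx ▸ pow_orderOf_eq_one x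
  have hx1 : p ^ (m - 1) • (θ - 1) x' = 0 := by
    rw [hsmul, End.sub_apply, ofAdd_sub, map_div, ← hb, div_eq_mul_inv]
    exact hcomm
  obtain ⟨F, hFb, hFa⟩ := exists_hom_of_relations p m hb hθ (hnot hbA) x' hx0 hx1
  have hFd : F (dU p m) = 1 := by
    have h := mul_prime_pow_eq p m hm hb hbc x' hx1
    -- Both `b` and `b * x` are outside `A`, so their powers vanish and the norm formula leaves
    -- exactly the image of `dU`.
    have hbx : b * f (Multiplicative.ofAdd x') ∉ A := fun h => hbA ((A.mul_mem_cancel_right hxA).1 h)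
    rw [hnot hbx, hnot hbA, one_mul] at h
    rw [dU, map_mul, map_pow, map_pow, hFa 0 hp.out.pos, hFa _ (Nat.sub_lt hp.out.pos one_pos), h,
      ofAdd_add, map_mul, ofAdd_nsmul, ofAdd_nsmul, map_pow, map_pow]
    rfl
  have hD : D p m ≤ F.ker := by
    rw [D, Subgroup.zpowers_le]
    exact hFd
  refine ⟨QuotientGroup.lift (D p m) F hD, fun y => ?_⟩
  -- A maximal subgroup containing the range would contain `x`, hence be `A`, yet contain `b`.
  have hrange : F.range = ⊤ := by
    by_contra h
    obtain ⟨M, hM, hle⟩ := exists_le_isCoatom h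
    have hxM : x ∈ M := hle ⟨aU p m 0, hFa 0 hp.out.pos⟩
    exact hbA (hmem hM hxM hx ▸ hle ⟨bU p m, hFb⟩)
  obtain ⟨u, rfl⟩ := MonoidHom.mem_range.1 (hrange ▸ Subgroup.mem_top y)
  exact ⟨u, rfl⟩


/-! ### Computations in `W` modulo the generator of `D` -/

section Coordinates

variable (p m : ℕ)

theorem nsmul_aN_eq_zero_iff {j : ℕ} (hj : j < p) (n : ℕ) :
    n • aN p m j = 0 ↔ ord p m ⟨j, hj⟩ ∣ n := by
  have h : aN p m j = Pi.single ⟨j, hj⟩ 1 := by simp [aN, hj, a]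
  rw [h, ← Pi.single_smul, Pi.single_eq_zero_iff, nsmul_eq_mul, mul_one,
    ZMod.natCast_eq_zero_iff]

theorem ord_of_ne_zero {j : ℕ} (hj : j < p) (h0 : j ≠ 0) : ord p m ⟨j, hj⟩ = p ^ (m - 1) := by
  simp [ord, h0]

theorem prod_ord (hp : 0 < p) : ∏ i : Fin p, ord p m i = p ^ m * (p ^ (m - 1)) ^ (p - 1) := by
  obtain ⟨q, rfl⟩ : ∃ q, p = q + 1 := ⟨p - 1, by omega⟩
  simp [Fin.prod_univ_succ, ord]

variable [hp : Fact p.Prime]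

theorem eq_sum_val_nsmul (w : AddW p m) : w = ∑ i : Fin p, (w i).val • a p m i := by
  conv_lhs => rw [← Finset.univ_sum_single w]
  refine Finset.sum_congr rfl fun i _ => ?_
  unfold a
  rw [← Pi.single_smul]
  simp

/-- The generator of `D`, as an element of `W` in additive notation. -/
def dW : AddW p m := p ^ (m - 1) • aN p m 0 + p ^ (m - 2) • aN p m (p - 1)

variable {m}

theorem nsmul_dW (hm : 2 ≤ m) : p • dW p m = 0 := by
  have h2 := hp.out.two_le
  rw [dW, smul_add, smul_smul, smul_smul, ← pow_succ', ← pow_succ',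
    show m - 1 + 1 = m by omega, show m - 2 + 1 = m - 1 by omega, pow_nsmul_aN,
    pow_pred_nsmul_aN _ _ _ (by omega), add_zero]

theorem aN_apply_zero {j : ℕ} (hj : j ≠ 0) : aN p m j ⟨0, hp.out.pos⟩ = 0 := by
  unfold aN
  split_ifs with h
  · exact Pi.single_eq_of_ne (by simpa [Fin.ext_iff] using hj.symm) _
  · rfl

theorem dW_apply_zero : dW p m ⟨0, hp.out.pos⟩ =
    ((p ^ (m - 1) : ℕ) : ZMod (ord p m ⟨0, hp.out.pos⟩)) := by
  have h2 := hp.out.two_le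
  rw [dW, Pi.add_apply, Pi.smul_apply, Pi.smul_apply, aN_apply_zero p (j := p - 1) (by omega),
    smul_zero, add_zero, aN, dif_pos hp.out.pos, a, Pi.single_eq_same, nsmul_eq_mul, mul_one]

/-- The coordinate of `dW` at `a₀` is `p ^ (m - 1)` modulo `p ^ m`, which already has order `p`; so
this coordinate is injective on the multiples of `dW`. -/
theorem eq_zero_of_mem_zmultiples_dW (hm : 2 ≤ m) {v : AddW p m}
    (hv : v ∈ AddSubgroup.zmultiples (dW p m)) (h0 : v ⟨0, hp.out.pos⟩ = 0) : v = 0 := by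
  have h2 := hp.out.two_le
  obtain ⟨k, rfl⟩ := AddSubgroup.mem_zmultiples_iff.1 hv
  rw [Pi.smul_apply, dW_apply_zero, zsmul_eq_mul, ← Int.cast_natCast (p ^ (m - 1)), ← Int.cast_mul,
    ZMod.intCast_zmod_eq_zero_iff_dvd] at h0
  have ho : ord p m ⟨0, hp.out.pos⟩ = p * p ^ (m - 1) := by
    simp only [ord, if_true]
    rw [← pow_succ']; congr 1; omega
  rw [ho, Nat.cast_mul] at h0
  obtain ⟨c, rfl⟩ := Int.dvd_of_mul_dvd_mul_right
    (by exact_mod_cast pow_ne_zero _ hp.out.ne_zero) h0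
  rw [mul_comm, mul_smul, natCast_zsmul, nsmul_dW p hm, smul_zero]

theorem aN_one_notMem (hm : 2 ≤ m) : aN p m 1 ∉ AddSubgroup.zmultiples (dW p m) := by
  intro h
  have h1 := eq_zero_of_mem_zmultiples_dW p hm h (aN_apply_zero p one_ne_zero)
  rw [← one_nsmul (aN p m 1), nsmul_aN_eq_zero_iff p m hp.out.one_lt,
    ord_of_ne_zero p _ _ one_ne_zero, Nat.dvd_one] at h1
  exact (Nat.one_lt_pow (by omega) hp.out.one_lt).ne' h1

theorem pow_nsmul_aN_zero_notMem (hm : 2 ≤ m) :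
    p ^ (m - 1) • aN p m 0 ∉ AddSubgroup.zmultiples (dW p m) := by
  have h2 := hp.out.two_le
  intro h
  have h1 : p ^ (m - 2) • aN p m (p - 1) ∈ AddSubgroup.zmultiples (dW p m) := by
    have := AddSubgroup.sub_mem _ (AddSubgroup.mem_zmultiples (dW p m)) h
    rwa [dW, add_sub_cancel_left] at this
  have h3 := eq_zero_of_mem_zmultiples_dW p hm h1 (by
    rw [Pi.smul_apply, aN_apply_zero p (by omega), smul_zero])
  rw [nsmul_aN_eq_zero_iff p m (by omega), ord_of_ne_zero p _ _ (by omega),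
    Nat.pow_dvd_pow_iff_le_right hp.out.one_lt] at h3
  omega

/-- The hypothesis `hpm` matters here. For odd `p` the element is `a₂`; for `p = 2` it is `-2 • a₁`,
which is nonzero because `a₁` has order at least 4. -/
theorem phiEnd_sub_one_aN_one_notMem (hm : 2 ≤ m) (hpm : p ≠ 2 ∨ 3 ≤ m) :
    (phiEnd p m - 1) (aN p m 1) ∉ AddSubgroup.zmultiples (dW p m) := by
  have h2 := hp.out.two_le
  intro h
  rcases h2.lt_or_eq with h3 | h3
  · rw [phiEnd_aN_of_lt _ _ _ (by omega)] at h
    have h1 := eq_zero_of_mem_zmultiples_dW p hm h (aN_apply_zero p two_ne_zero)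
    rw [← one_nsmul (aN p m 2), nsmul_aN_eq_zero_iff p m h3,
      ord_of_ne_zero p _ _ two_ne_zero, Nat.dvd_one] at h1
    exact (Nat.one_lt_pow (by omega) hp.out.one_lt).ne' h1
  · subst h3
    have h4 := phiEnd_aN_last 2 m
    simp only [Nat.add_one_sub_one, Finset.Icc_self, Finset.sum_singleton,
      Nat.choose_one_right] at h4
    rw [h4, neg_mem_iff] at h
    have h1 := eq_zero_of_mem_zmultiples_dW 2 hm h (by
      rw [Pi.smul_apply, aN_apply_zero 2 one_ne_zero, smul_zero])
    rw [nsmul_aN_eq_zero_iff 2 m one_lt_two, ord_of_ne_zero 2 _ _ one_ne_zero] at h1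
    have := Nat.le_of_dvd two_pos h1
    have : 2 ^ 2 ≤ 2 ^ (m - 1) := Nat.pow_le_pow_right two_pos (by omega)
    omega

theorem pow_nsmul_phiEnd_sub_one (w : AddW p m) : p ^ (m - 1) • (phiEnd p m - 1) w = 0 := by
  have h2 := hp.out.two_le
  rw [eq_sum_val_nsmul p m w, map_sum, Finset.smul_sum]
  refine Finset.sum_eq_zero fun i _ => ?_
  have hai : a p m i = aN p m i := by simp [aN]
  rw [map_nsmul, smul_comm, hai]
  rcases lt_or_ge ((i : ℕ) + 1) p with hi | hi
  · rw [phiEnd_aN_of_lt _ _ _ hi, pow_pred_nsmul_aN _ _ _ (by omega), smul_zero]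
  · rw [← map_nsmul, pow_pred_nsmul_aN _ _ _ (by omega), map_zero, smul_zero]

/-- By linearity only generators matter. At `a₀` the expression is `dW`. At later ones the first
term vanishes, and the second is an image of `p ^ (m - 2) • (φ - 1) a_{p-1}`, which is zero. -/
theorem norm_mem_zmultiples (w : AddW p m) :
    p ^ (m - 1) • w + p ^ (m - 2) • ((phiEnd p m - 1) ^ (p - 1)) w ∈
      AddSubgroup.zmultiples (dW p m) := by
  have h2 := hp.out.two_le
  set S := AddSubgroup.zmultiples (dW p m)
  have key (i : Fin p) : p ^ (m - 1) • a p m i +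
      p ^ (m - 2) • ((phiEnd p m - 1) ^ (p - 1)) (a p m i) ∈ S := by
    have hai : a p m i = aN p m i := by simp [aN]
    rw [hai]
    rcases Nat.eq_zero_or_pos (i : ℕ) with h0 | h0
    · rw [h0, pow_aN_zero _ _ _ (by omega)]
      exact AddSubgroup.mem_zmultiples _
    · obtain ⟨k, hk⟩ : ∃ k, (i : ℕ) = k + 1 := ⟨i - 1, by omega⟩
      rw [pow_pred_nsmul_aN _ _ _ (by omega), zero_add, ← pow_aN_zero _ _ _ i.2,
        ← end_mul_apply, ← pow_add, show p - 1 + (i : ℕ) = k + (1 + (p - 1)) by omega, pow_add,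
        pow_add, end_mul_apply, end_mul_apply, pow_aN_zero _ _ _ (by omega), pow_one,
        phiEnd_aN_last, ← map_nsmul, nsmul_eq_zero_of_sum, map_zero]
      exact S.zero_mem
  have hw := eq_sum_val_nsmul p m w
  have : p ^ (m - 1) • w + p ^ (m - 2) • ((phiEnd p m - 1) ^ (p - 1)) w =
      ∑ i : Fin p, (w i).val • (p ^ (m - 1) • a p m i +
        p ^ (m - 2) • ((phiEnd p m - 1) ^ (p - 1)) (a p m i)) := by
    conv_lhs => rw [hw]
    rw [map_sum, Finset.smul_sum, Finset.smul_sum, ← Finset.sum_add_distrib]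
    refine Finset.sum_congr rfl fun i _ => ?_
    rw [map_nsmul, smul_add, smul_comm (p ^ (m - 1)), smul_comm (p ^ (m - 2))]
  rw [this]
  exact sum_mem fun i _ => S.nsmul_mem (key i) _

end Coordinates

/-! ### The structure of `U / D` and its abelian subgroup -/

section Quotient

variable (p m : ℕ) [hp : Fact p.Prime]

/-- The homomorphism `W → U / D`. -/
noncomputable def iotaQ : W p m →* U p m ⧸ D p m :=
  (QuotientGroup.mk' (D p m)).comp SemidirectProduct.inl

/-- The image of `b₀` in `U / D`. -/
noncomputable def betaQ : U p m ⧸ D p m := QuotientGroup.mk' (D p m) (bU p m)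

theorem betaQ_conj (v : AddW p m) :
    (betaQ p m)⁻¹ * iotaQ p m (Multiplicative.ofAdd v) * betaQ p m =
      iotaQ p m (Multiplicative.ofAdd (phiEnd p m v)) :=
  congrArg (QuotientGroup.mk' (D p m)) (bU_inv_mul_mul p m (Multiplicative.ofAdd v))

theorem iotaQ_eq_one_iff (v : AddW p m) :
    iotaQ p m (Multiplicative.ofAdd v) = 1 ↔ v ∈ AddSubgroup.zmultiples (dW p m) := by
  rw [iotaQ, MonoidHom.comp_apply, QuotientGroup.mk'_apply, QuotientGroup.eq_one_iff, D,
    dU_eq, Subgroup.mem_zpowers_iff, AddSubgroup.mem_zmultiples_iff]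
  refine exists_congr fun k => ?_
  rw [← map_zpow, SemidirectProduct.inl_inj, ← ofAdd_zsmul]
  exact Multiplicative.ofAdd.injective.eq_iff

theorem betaQ_pow : betaQ p m ^ p ^ (m - 1) = 1 := by
  rw [betaQ, ← map_pow, bU, ← map_pow, ← ofAdd_nsmul]
  simp

theorem commute_betaQ_pow (w : W p m) : Commute (betaQ p m ^ p) (iotaQ p m w) := by
  have h := apply_pow_eq_conj (betaQ_conj p m) p w.toAdd
  rw [phiEnd_pow, mul_assoc] at h
  exact (inv_mul_eq_iff_eq_mul.1 h.symm).symm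

theorem exists_eq_iotaQ_mul (q : U p m ⧸ D p m) :
    ∃ w, ∃ n : ℕ, q = iotaQ p m w * betaQ p m ^ n := by
  obtain ⟨u, rfl⟩ := QuotientGroup.mk'_surjective (D p m) q
  obtain ⟨n, hn⟩ := exists_eq_ofAdd_one_pow p m u.right
  refine ⟨u.left, n, ?_⟩
  rw [betaQ, iotaQ, MonoidHom.comp_apply, ← map_pow, ← map_mul, bU, ← map_pow, ← hn,
    SemidirectProduct.inl_left_mul_inr_right]

/-- The abelian maximal subgroup of `U / D`. -/
noncomputable def abelianQ : Subgroup (U p m ⧸ D p m) where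
  carrier := {q | ∃ w, ∃ n : ℤ, q = iotaQ p m w * (betaQ p m ^ p) ^ n}
  one_mem' := ⟨1, 0, by simp⟩
  mul_mem' := by
    rintro _ _ ⟨w, n, rfl⟩ ⟨w', n', rfl⟩
    refine ⟨w * w', n + n', ?_⟩
    rw [map_mul, zpow_add, mul_assoc, ← mul_assoc (_ ^ n),
      ((commute_betaQ_pow p m w').zpow_left n).eq]
    simp only [mul_assoc]
  inv_mem' := by
    rintro _ ⟨w, n, rfl⟩
    refine ⟨w⁻¹, -n, ?_⟩
    rw [mul_inv_rev, map_inv, zpow_neg, ← mul_inv_rev, ← mul_inv_rev,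
      ((commute_betaQ_pow p m w).zpow_left n).eq]

theorem iotaQ_mem_abelianQ (w : W p m) : iotaQ p m w ∈ abelianQ p m := ⟨w, 0, by simp⟩

theorem isMulCommutative_abelianQ : IsMulCommutative (abelianQ p m) := by
  refine .of_setLike_mul_comm ?_
  rintro _ ⟨w, n, rfl⟩ _ ⟨w', n', rfl⟩
  have h (n : ℤ) (w) := (commute_betaQ_pow p m w).zpow_left n
  have hw : Commute (iotaQ p m w) (iotaQ p m w') := (Commute.all w w').map _
  exact (hw.mul_right (h n' w).symm).mul_left ((h n w').mul_right (Commute.zpow_zpow_self _ _ _))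

/-- The exponent `n` of `b₀` in `y` is prime to `p`, and `k` is its inverse modulo `p`. Passing to
`y ^ k` keeps the order and reduces to the coset of `b₀`. -/
theorem exists_pow_eq_betaQ_mul {y : U p m ⧸ D p m} (hy : y ∉ abelianQ p m) :
    ∃ k : ℕ, k.Coprime p ∧ ∃ w, ∃ n : ℤ,
      y ^ k = betaQ p m * (iotaQ p m w * (betaQ p m ^ p) ^ n) := by
  obtain ⟨w, n, rfl⟩ := exists_eq_iotaQ_mul p m y
  have hn : n.Coprime p := by
    refine (Nat.coprime_comm.1 ((Nat.Prime.coprime_iff_not_dvd hp.out).2 ?_))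
    rintro ⟨c, rfl⟩
    exact hy ⟨w, c, by rw [zpow_natCast, ← pow_mul]⟩
  obtain ⟨k, -, hk⟩ := Nat.exists_mul_mod_eq_one_of_coprime hn hp.out.one_lt
  have hkp : n * k = p * (n * k / p) + 1 := by
    conv_lhs => rw [← Nat.div_add_mod (n * k) p, hk]
  have hpow (k : ℕ) : ∃ w', (iotaQ p m w * betaQ p m ^ n) ^ k =
      betaQ p m ^ (n * k) * iotaQ p m w' := by
    induction k with
    | zero => exact ⟨1, by simp⟩
    | succ k ih =>
      obtain ⟨w', hw'⟩ := ih
      refine ⟨Multiplicative.ofAdd ((phiEnd p m ^ n) (w'.toAdd + w.toAdd)), ?_⟩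
      rw [pow_succ, hw', apply_pow_eq_conj (betaQ_conj p m), ofAdd_add, map_mul, ofAdd_toAdd,
        ofAdd_toAdd, mul_add, mul_one, pow_add]
      group
  obtain ⟨w', hw'⟩ := hpow k
  refine ⟨k, ?_, w', (n * k / p : ℕ), ?_⟩
  · refine Nat.coprime_of_mul_modEq_one n ?_
    rw [mul_comm, Nat.ModEq, hk, Nat.mod_eq_of_lt hp.out.one_lt]
  · rw [hw', hkp, pow_succ', zpow_natCast, mul_assoc, pow_mul,
      ((commute_betaQ_pow p m w').pow_left _).eq, ← hkp]

end Quotient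

/-! ### `U / D` is of type A -/

section Quotient

variable (p m : ℕ) [hp : Fact p.Prime]

theorem card_quotient (hm : 2 ≤ m) : Nat.card (U p m ⧸ D p m) = p ^ ((m - 1) * (p + 1)) := by
  have hD : Nat.card (D p m) = p := by
    rw [D, Nat.card_zpowers]
    refine orderOf_eq_prime ?_ fun h => ?_
    · rw [dU_eq, ← map_pow, ← ofAdd_nsmul]
      change SemidirectProduct.inl (Multiplicative.ofAdd (p • dW p m)) = 1
      rw [nsmul_dW p hm, ofAdd_zero, map_one]
    · rw [dU_eq, map_eq_one_iff _ SemidirectProduct.inl_injective, ofAdd_eq_one] at h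
      have h1 : dW p m ⟨0, hp.out.pos⟩ = 0 := congrFun h _
      rw [dW_apply_zero, ZMod.natCast_eq_zero_iff, ord, if_pos rfl,
        Nat.pow_dvd_pow_iff_le_right hp.out.one_lt] at h1
      omega
  have hW : Nat.card (W p m) = p ^ m * (p ^ (m - 1)) ^ (p - 1) := by
    rw [← prod_ord p m hp.out.pos]
    change Nat.card (AddW p m) = _
    rw [Nat.card_pi]
    simp
  have hU : Nat.card (U p m) = p ^ m * (p ^ (m - 1)) ^ (p - 1) * p ^ (m - 1) := by
    rw [SemidirectProduct.card, hW]
    congr 1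
    exact Nat.card_zmod _
  have h := (D p m).card_eq_card_quotient_mul_card_subgroup
  rw [hD, hU, ← pow_mul, ← pow_add, ← pow_add] at h
  refine Nat.eq_of_mul_eq_mul_right hp.out.pos (h.symm.trans ?_)
  rw [← pow_succ]
  congr 1
  obtain ⟨q, hq⟩ : ∃ q, p = q + 1 := ⟨p - 1, (Nat.succ_pred_prime hp.out).symm⟩
  obtain ⟨n, rfl⟩ : ∃ n, m = n + 1 := ⟨m - 1, by omega⟩
  rw [hq]
  simp only [Nat.add_sub_cancel]
  ring

theorem isPGroup_quotient (hm : 2 ≤ m) : IsPGroup p (U p m ⧸ D p m) :=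
  IsPGroup.of_card (card_quotient p m hm)

theorem sub_mem_zmultiples_of_iotaQ_eq {v w : AddW p m}
    (h : iotaQ p m (Multiplicative.ofAdd v) = iotaQ p m (Multiplicative.ofAdd w)) :
    v - w ∈ AddSubgroup.zmultiples (dW p m) := by
  rw [← iotaQ_eq_one_iff, ofAdd_sub, map_div, h, div_self']

theorem not_isMulCommutative_quotient (hm : 2 ≤ m) : ¬ IsMulCommutative (U p m ⧸ D p m) := by
  intro h
  have h1 := betaQ_conj p m (aN p m 0)
  rw [mul_assoc, mul_comm' (iotaQ p m _), inv_mul_cancel_left] at h1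
  have h2 := sub_mem_zmultiples_of_iotaQ_eq p m h1.symm
  refine aN_one_notMem p hm ?_
  rwa [← phiEnd_aN_of_lt p m 0 (by have := hp.out.two_le; omega)]

theorem pow_eq_one_of_notMem_abelianQ (hm : 2 ≤ m) {y : U p m ⧸ D p m}
    (hy : y ∉ abelianQ p m) : y ^ p ^ (m - 1) = 1 := by
  obtain ⟨k, hk, w, n, hkn⟩ := exists_pow_eq_betaQ_mul p m hy
  have hc : Commute (betaQ p m * iotaQ p m w) ((betaQ p m ^ p) ^ n) :=
    ((((Commute.refl _).pow_left p).mul_right (commute_betaQ_pow p m w)).zpow_left n).symm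
  have h1 : (y ^ k) ^ p ^ (m - 1) = 1 := by
    rw [hkn, ← mul_assoc, hc.mul_pow, ← zpow_natCast ((betaQ p m ^ p) ^ n), ← zpow_mul, mul_comm n,
      zpow_mul, zpow_natCast, ← pow_mul, mul_comm p, pow_mul, betaQ_pow, one_pow, one_zpow, mul_one]
    have h := mul_prime_pow_eq p m hm (betaQ_conj p m) (commute_betaQ_pow p m) w.toAdd
      (pow_nsmul_phiEnd_sub_one p _)
    rw [ofAdd_toAdd] at h
    rw [h, betaQ_pow, one_mul, iotaQ_eq_one_iff]
    exact norm_mem_zmultiples p _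
  -- The order of `y` is a power of `p`, so the factor `k` can be cancelled.
  rw [← pow_mul, ← orderOf_dvd_iff_pow_eq_one] at h1
  obtain ⟨s, hs⟩ := IsPGroup.iff_orderOf.1 (isPGroup_quotient p m hm) y
  rw [← orderOf_dvd_iff_pow_eq_one]
  refine Nat.Coprime.dvd_of_dvd_mul_left ?_ h1
  rw [hs]
  exact hk.symm.pow_left s

theorem isCoatom_abelianQ (hm : 2 ≤ m) : IsCoatom (abelianQ p m) := by
  refine ⟨fun h => not_isMulCommutative_quotient p m hm (isMulCommutative_iff.2 fun x y => ?_),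
    fun M hM => eq_top_iff.2 fun q _ => ?_⟩
  · have := isMulCommutative_abelianQ p m
    exact setLike_mul_comm (s := abelianQ p m) (h ▸ Subgroup.mem_top x) (h ▸ Subgroup.mem_top y)
  · obtain ⟨y, hyM, hy⟩ := SetLike.exists_of_lt hM
    obtain ⟨k, -, w, n, hkn⟩ := exists_pow_eq_betaQ_mul p m hy
    have hβ : betaQ p m ∈ M := by
      rw [← M.mul_mem_cancel_right (hM.le ⟨w, n, rfl⟩), ← hkn]
      exact M.pow_mem hyM k
    obtain ⟨w', n', rfl⟩ := exists_eq_iotaQ_mul p m q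
    exact M.mul_mem (hM.le (iotaQ_mem_abelianQ p m w')) (M.pow_mem hβ n')

/-- For `j ≥ 1`, `a_j = (φ - 1) a_{j-1}` is a commutator with `b₀`. -/
theorem iotaQ_aN_mem_of_isCoatom (hm : 2 ≤ m) {M : Subgroup (U p m ⧸ D p m)} (hM : IsCoatom M)
    {j : ℕ} (hj : j ≠ 0) (hjp : j < p) : iotaQ p m (Multiplicative.ofAdd (aN p m j)) ∈ M := by
  obtain ⟨i, rfl⟩ := Nat.exists_eq_succ_of_ne_zero hj
  rw [Nat.succ_eq_add_one, ← phiEnd_aN_of_lt p m i hjp, end_sub_apply, ofAdd_sub, map_div,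
    end_one_apply, ← betaQ_conj, div_eq_mul_inv]
  exact commutator_mem_of_isCoatom (isPGroup_quotient p m hm) hM _ _

theorem hasUniqueAbelianMaximal_quotient (hm : 2 ≤ m) (hpm : p ≠ 2 ∨ 3 ≤ m) :
    HasUniqueAbelianMaximal (U p m ⧸ D p m) := by
  have hAc := isMulCommutative_abelianQ p m
  refine ⟨abelianQ p m, ⟨isCoatom_abelianQ p m hm, hAc⟩, ?_⟩
  rintro M ⟨hM, hMc⟩
  by_contra hne
  obtain ⟨y, hyM, hy⟩ : ∃ y ∈ M, y ∉ abelianQ p m := by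
    by_contra! h
    exact (hM.le_iff.1 h).elim (isCoatom_abelianQ p m hm).1 (fun h => hne h.symm)
  obtain ⟨k, -, w, n, hkn⟩ := exists_pow_eq_betaQ_mul p m hy
  set c := iotaQ p m (Multiplicative.ofAdd (aN p m 1))
  have hcM : c ∈ M := iotaQ_aN_mem_of_isCoatom p m hm hM one_ne_zero hp.out.one_lt
  have h1 : Commute (y ^ k) c := setLike_mul_comm (M.pow_mem hyM k) hcM
  have h2 : Commute (iotaQ p m w * (betaQ p m ^ p) ^ n) c :=
    setLike_mul_comm (s := abelianQ p m) ⟨w, n, rfl⟩ (iotaQ_mem_abelianQ p m _)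
  -- Cancelling the factor in `abelianQ` shows that `b₀` centralizes `a₁` modulo `D`, against
  -- `phiEnd_sub_one_aN_one_notMem`.
  have h3 : Commute (betaQ p m) c := by
    have := h1.mul_left h2.inv_left
    rwa [hkn, mul_inv_cancel_right] at this
  have h4 := betaQ_conj p m (aN p m 1)
  rw [mul_assoc, ← h3.eq, inv_mul_cancel_left] at h4
  exact phiEnd_sub_one_aN_one_notMem p hm hpm (sub_mem_zmultiples_of_iotaQ_eq p m h4.symm)

/-- An element `x` of order `p ^ m` and an element `y` outside the abelian maximal subgroup lie in
no common maximal subgroup. -/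
theorem not_isCoatom_of_mem (hm : 2 ≤ m) {M : Subgroup (U p m ⧸ D p m)}
    {x y : U p m ⧸ D p m} (hx : x ∈ M) (hxo : x ^ p ^ (m - 1) ≠ 1) (hy : y ∈ M)
    (hyA : y ∉ abelianQ p m) : ¬ IsCoatom M := by
  intro hM
  have hG := isPGroup_quotient p m hm
  have hβp : betaQ p m ^ p ∈ M := pow_mem_of_isCoatom hG hM _
  have hxA : x ∈ abelianQ p m := by
    by_contra h
    exact hxo (pow_eq_one_of_notMem_abelianQ p m hm h)
  obtain ⟨w, n, rfl⟩ := hxA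
  rw [M.mul_mem_cancel_right (M.zpow_mem hβp n)] at hx
  let K : AddSubgroup (AddW p m) := Subgroup.toAddSubgroup' (M.comap (iotaQ p m))
  have hK (v : AddW p m) : v ∈ K ↔ iotaQ p m (Multiplicative.ofAdd v) ∈ M := Iff.rfl
  have hKi (i : Fin p) (hi : (i : ℕ) ≠ 0) : a p m i ∈ K := by
    have := iotaQ_aN_mem_of_isCoatom p m hm hM hi i.2
    rw [hK]
    simpa [aN] using this
  let i0 : Fin p := ⟨0, hp.out.pos⟩
  have hne {i : Fin p} (hi : i ≠ i0) : (i : ℕ) ≠ 0 := fun h => hi (Fin.ext h)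
  let v : AddW p m := w.toAdd
  have hv : v ∈ K := hx
  have hsum := eq_sum_val_nsmul p m v
  rw [← Finset.add_sum_erase _ _ (Finset.mem_univ i0)] at hsum
  have h0 : (v i0).val • a p m i0 ∈ K := by
    rw [hsum] at hv
    exact (K.add_mem_cancel_right (sum_mem fun i hi =>
      K.nsmul_mem (hKi i (hne (Finset.ne_of_mem_erase hi))) _)).1 hv
  -- Only `a₀` has order `p ^ m`; were its coefficient divisible by `p`, the power `p ^ (m - 1)` of
  -- `x` would be trivial.
  have hcop : ((v i0).val).Coprime p := by
    refine (Nat.coprime_comm.1 ((Nat.Prime.coprime_iff_not_dvd hp.out).2 ?_))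
    rintro ⟨c, hc⟩
    have hpv : p ^ (m - 1) • v = 0 := by
      rw [hsum, hc, smul_add, smul_smul, ← mul_assoc, ← pow_succ, mul_comm, mul_smul,
        show m - 1 + 1 = m by omega, Finset.smul_sum, Finset.sum_eq_zero]
      · have : a p m i0 = aN p m 0 := by simp [aN, hp.out.pos, i0]
        rw [this, pow_nsmul_aN, smul_zero, zero_add]
      · intro i hi
        have : a p m i = aN p m i := by simp [aN]
        rw [smul_comm, this, pow_pred_nsmul_aN _ _ _ (hne (Finset.ne_of_mem_erase hi)), smul_zero]
    refine hxo ?_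
    rw [((commute_betaQ_pow p m w).zpow_left n).symm.mul_pow, ← map_pow,
      ← zpow_natCast ((betaQ p m ^ p) ^ n), ← zpow_mul, mul_comm n, zpow_mul, zpow_natCast,
      ← pow_mul, mul_comm p, pow_mul, betaQ_pow, one_pow, one_zpow, mul_one]
    exact (congrArg (fun v => iotaQ p m (Multiplicative.ofAdd v)) hpv).trans (map_one _)
  have hp0 : p • a p m i0 ∈ K := by
    rw [hK, ofAdd_nsmul, map_pow]
    exact pow_mem_of_isCoatom hG hM _
  -- Bézout, from a multiple of `a₀` prime to `p` and from `p • a₀`. Then `M` contains `abelianQ`,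
  -- so equals it, although `y ∈ M`.
  have ha0 : a p m i0 ∈ K := by
    obtain ⟨s, t, hst⟩ := Nat.isCoprime_iff_coprime.2 hcop
    have := K.add_mem (K.zsmul_mem h0 s) (K.zsmul_mem hp0 t)
    rwa [← natCast_zsmul, ← natCast_zsmul, smul_smul, smul_smul, ← add_smul, hst, one_smul] at this
  have hKtop (v : AddW p m) : v ∈ K := by
    rw [eq_sum_val_nsmul p m v]
    refine sum_mem fun i _ => K.nsmul_mem ?_ _
    by_cases hi : i = i0
    · exact hi ▸ ha0
    · exact hKi i (hne hi)
  have hAM : abelianQ p m ≤ M := by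
    rintro _ ⟨w, n, rfl⟩
    exact M.mul_mem (hKtop w.toAdd) (M.zpow_mem hβp n)
  refine hM.1 ((isCoatom_abelianQ p m hm).2 M (lt_of_le_of_ne hAM ?_))
  rintro rfl
  exact hyA hy

theorem exponent_quotient (hm : 2 ≤ m) : Monoid.exponent (U p m ⧸ D p m) = p ^ m := by
  have h : Monoid.exponent (U p m ⧸ D p m) ∣ p ^ m := by
    refine Monoid.exponent_dvd_of_forall_pow_eq_one fun q => ?_
    have hpm : p ^ m = p ^ (m - 1) * p := by rw [← pow_succ]; congr 1; omega
    by_cases hq : q ∈ abelianQ p m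
    · obtain ⟨w, n, rfl⟩ := hq
      rw [((commute_betaQ_pow p m w).zpow_left n).symm.mul_pow, ← map_pow,
        ← zpow_natCast ((betaQ p m ^ p) ^ n), ← zpow_mul, mul_comm n, zpow_mul, zpow_natCast,
        ← pow_mul, mul_comm p]
      nth_rw 2 [hpm]
      rw [mul_assoc, pow_mul, betaQ_pow, one_pow, one_zpow, mul_one]
      have hw : p ^ m • w.toAdd = 0 := by
        rw [eq_sum_val_nsmul p m w.toAdd, Finset.smul_sum, Finset.sum_eq_zero]
        intro i _
        have : a p m i = aN p m i := by simp [aN]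
        rw [smul_comm, this, pow_nsmul_aN, smul_zero]
      exact (congrArg (fun v => iotaQ p m (Multiplicative.ofAdd v)) hw).trans (map_one _)
    · rw [hpm, pow_mul, pow_eq_one_of_notMem_abelianQ p m hm hq, one_pow]
  obtain ⟨k, hk, hE⟩ := (Nat.dvd_prime_pow hp.out).1 h
  rcases hk.eq_or_lt with rfl | hk
  · exact hE
  · exfalso
    have h1 : Monoid.exponent (U p m ⧸ D p m) ∣ p ^ (m - 1) := hE ▸ pow_dvd_pow p (by omega)
    have h2 := Monoid.exponent_dvd_iff_forall_pow_eq_one.1 h1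
      (iotaQ p m (Multiplicative.ofAdd (aN p m 0)))
    rw [← map_pow, ← ofAdd_nsmul, iotaQ_eq_one_iff] at h2
    exact pow_nsmul_aN_zero_notMem p hm h2

theorem isExponentCritical_quotient (hm : 2 ≤ m) : IsExponentCritical (U p m ⧸ D p m) := by
  intro h
  have hdvd : Monoid.exponent (U p m ⧸ D p m) ∣ p ^ (m - 1) := by
    rw [h]
    refine Finset.lcm_dvd fun H hH => ?_
    simp only [Set.Finite.mem_toFinset, Set.mem_ofPred_eq] at hH
    obtain ⟨hH, hHc⟩ := hH
    obtain ⟨M, hM, hHM⟩ := exists_le_isCoatom hH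
    -- A non-abelian `H` leaves `abelianQ`; being proper, it then contains no element of order `p ^
    -- m`.
    obtain ⟨y, hyH, hy⟩ : ∃ y ∈ H, y ∉ abelianQ p m := by
      by_contra! hle
      have := isMulCommutative_abelianQ p m
      exact hHc (.of_setLike_mul_comm fun x hx y hy =>
        setLike_mul_comm (s := abelianQ p m) (hle x hx) (hle y hy))
    refine Monoid.exponent_dvd_of_forall_pow_eq_one fun x => Subtype.ext ?_
    by_contra hx
    exact not_isCoatom_of_mem p m hm (hHM x.2) hx (hHM hyH) hy hM
  rw [exponent_quotient p m hm, Nat.pow_dvd_pow_iff_le_right hp.out.one_lt] at hdvd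
  omega

theorem isTypeA_quotient (hm : 2 ≤ m) (hpm : p ≠ 2 ∨ 3 ≤ m) : IsTypeA p m (U p m ⧸ D p m) where
  isPGroup := isPGroup_quotient p m hm
  nonabelian := not_isMulCommutative_quotient p m hm
  exponentCritical := isExponentCritical_quotient p m hm
  exponent_eq := exponent_quotient p m hm
  typeA := hasUniqueAbelianMaximal_quotient p m hm hpm

end Quotient

end ExpCrit

theorem mainTheorem8 (p : ℕ) [Fact p.Prime] (m : ℕ) (hm : 2 ≤ m) (hpm : p ≠ 2 ∨ 3 ≤ m) :
    ExpCrit.IsTypeA p m (ExpCrit.U p m ⧸ ExpCrit.D p m) ∧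
    Nat.card (ExpCrit.U p m ⧸ ExpCrit.D p m) = p ^ ((m - 1) * (p + 1)) ∧
    ∀ (P : Type*) [Group P] [Finite P], ExpCrit.IsTypeA p m P →
      (∃ f : (ExpCrit.U p m ⧸ ExpCrit.D p m) →* P, Function.Surjective f) ∧
      Nat.card P ≤ Nat.card (ExpCrit.U p m ⧸ ExpCrit.D p m) ∧
      (Nat.card P = Nat.card (ExpCrit.U p m ⧸ ExpCrit.D p m) →
        Nonempty (P ≃* (ExpCrit.U p m ⧸ ExpCrit.D p m))) := by
  refine ⟨ExpCrit.isTypeA_quotient p m hm hpm, ExpCrit.card_quotient p m hm, fun P _ _ hP => ?_⟩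
  obtain ⟨f, hf⟩ := hP.exists_surjective hm
  refine ⟨⟨f, hf⟩, Nat.card_le_card_of_surjective f hf, fun hcard => ?_⟩
  have hbij : Function.Bijective f := (Nat.bijective_iff_surjective_and_card f).2 ⟨hf, hcard.symm⟩
  exact ⟨(MulEquiv.ofBijective f hbij).symm⟩
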